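/- Conventions. $\mathbb{N}=\{1,2,\dots\}$. For $x\in\mathbb{R}^n$, $\|x\|_p$ is the $\ell_p$-norm, $p\in[1,\infty]$. A hypercube in $\mathbb{R}^m$ is a set $[a,b]^m$ with $a<b$ real. A ReLU network $\Phi$ with layer dimensions $\ell_0,\dots,\ell_L\in\mathbb{N}$ ($L\in\mathbb{N}$) is a tuple $((W_1,b_1),\dots,(W_L,b_L))$ with $W_i\in\mathbb{R}^{\ell_i\times\ell_{i-1}}$, $b_i\in\mathbb{R}^{\ell_i}$. Its realization is $\mathcal{R}(\Phi)=\mathcal{A}_L\circ\mathfrak{r}\circ\mathcal{A}_{L-1}\circ\cdots\circ\mathfrak{r}\circ\mathcal{A}_1:\mathbb{R}^{\ell_0}\to\mathbb{R}^{\ell_L}$, where $\mathcal{A}_i(x)=W_ix+b_i$ and $\mathfrak{r}(x)=(\max\{x_j,0\})_j$; its number of parameters is $\mathcal{P}(\Phi)=\sum_{i=1}^L\ell_i(\ell_{i-1}+1)$. For $x\in\mathbb{R}^m$ let $m_m(x)=\max\{x_1,\dots,x_m\}$, $p_m(x)=\prod_{j=1}^m x_j$, $\mathfrak{m}_m(x)=(m_1(x_1),m_2(x_1,x_2),\dots,m_m(x_1,\dots,x_m))$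 and $\mathfrak{p}_m(x)=(p_1(x_1),p_2(x_1,x_2),\dots,p_m(x_1,\dots,x_m))$. Let $Q=[a,b]^m$ be a hypercube. For $n,m_1,\dots,m_n\in\mathbb{N}$ with $\sum_i m_i=m$ and $f_i:[a,b]^{m_i}\to\mathbb{R}$, the parallelization $f_1\square\cdots\square f_n:Q\to\mathbb{R}^n$ is $(x_1,\dots,x_n)\mapsto(f_1(x_1),\dots,f_n(x_n))$, $x_i\in[a,b]^{m_i}$. Let $\mathscr{P}_{c,p}(Q,\Lambda)$ be the set of all such parallelizations (with arbitrary $n,m_1,\dots,m_n$) in which every $m_i\le c$ and $|f_i(x)-f_i(y)|\le\Lambda\|x-y\|_p$ for all $x,y\in[a,b]^{m_i}$; let $\mathbf{M}(Q)$ (resp. $\mathbf{P}(Q)$) be the set of those in which every $f_i$ is $m_{m_i}|_{[a,b]^{m_i}}$ (resp. $p_{m_i}|_{[a,b]^{m_i}}$). Theorem. Let $c,k\in\mathbb{N}$ and $p\in[1,\infty]$. For every $d\in\mathbb{N}$ let $\mathfrak{d}^d_1,\dots,\mathfrak{d}^d_{k+1}\in\{1,\dots,cd^c\}$, and for $i\in\{1,\dots,k\}$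 let $Q_i^d\subseteq[-cd^c,cd^c]^{\mathfrak{d}_i^d}$ be a $\mathfrak{d}_i^d$-dimensional hypercube and $g_i^d\in C(Q_i^d,\mathbb{R}^{\mathfrak{d}_{i+1}^d})$. Assume for all $d\in\mathbb{N}$ that 1. $g_i^d\in\mathscr{P}_{c,p}(Q_i^d,cd^c)\cup\{\mathfrak{m}_{\mathfrak{d}_i^d}|_{Q_i^d}\}\cup\{\mathfrak{p}_{\mathfrak{d}_i^d}|_{Q_i^d}\}\cup\mathbf{M}(Q_i^d)\cup\mathbf{P}(Q_i^d)$ for all $i\in\{1,\dots,k\}$; 2. $g_i^d(Q_i^d)\subseteq Q_{i+1}^d$ for all $i\in\{1,\dots,k-1\}$; 3. $Q_i^d\subseteq[-1,1]^{\mathfrak{d}_i^d}$ for all $i\in\{1,\dots,k\}$ with $g_i^d\in\mathbf{P}(Q_i^d)\cup\{\mathfrak{p}_{\mathfrak{d}_i^d}|_{Q_i^d}\}$. Let $F_d=g_k^d\circ g_{k-1}^d\circ\cdots\circ g_1^d\in C(Q_1^d,\mathbb{R}^{\mathfrak{d}_{k+1}^d})$. Then there exists $K\in\mathbb{N}$ such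 that for every $d\in\mathbb{N}$ and $\varepsilon\in(0,1]$ there is a ReLU network $\Phi$ with $\mathcal{R}(\Phi)\in C(\mathbb{R}^{\mathfrak{d}_1^d},\mathbb{R}^{\mathfrak{d}_{k+1}^d})$, $$\mathcal{P}(\Phi)\le K d^K\varepsilon^{-2c}\qquad\text{and}\qquad\forall x\in Q_1^d:\ \|\mathcal{R}(\Phi)(x)-F_d(x)\|_p\le\varepsilon.$$ -/

import Mathlib

open scoped ENNReal Matrix

namespace ReLUApprox

/-- Fully connected feedforward networks with input dimension `m` and output dimension `n`:
a nonempty finite list of pairs (weight matrix, bias vector) with matching dimensions, all of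
which are positive. `last W b` is the network with the single layer `(W, b)`, and
`layer W b Φ` puts the layer `(W, b)` in front of the network `Φ`. -/
inductive Network : ℕ → ℕ → Type
  | last {m n : ℕ} (hm : 0 < m) (hn : 0 < n)
      (W : Matrix (Fin n) (Fin m) ℝ) (b : Fin n → ℝ) : Network m n
  | layer {m l n : ℕ} (hm : 0 < m)
      (W : Matrix (Fin l) (Fin m) ℝ) (b : Fin l → ℝ) (Φ : Network l n) : Network m n

/-- The multidimensional ReLU activation. -/
noncomputable def relu {n : ℕ} (x : Fin n → ℝ) : Fin n → ℝ := fun i => max (x i) 0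

/-- The realization of a network: the affine layer maps composed, with the ReLU activation after
every layer except the last one. -/
noncomputable def Network.realize : {m n : ℕ} → Network m n → (Fin m → ℝ) → (Fin n → ℝ)
  | _, _, .last _ _ W b, x => W *ᵥ x + b
  | _, _, .layer _ W b Φ, x => Φ.realize (relu (W *ᵥ x + b))

/-- The number of parameters `∑ᵢ ℓᵢ (ℓᵢ₋₁ + 1)` of a network with layer dimensions
`ℓ₀, …, ℓ_L`. -/
def Network.params : {m n : ℕ} → Network m n → ℕ
  | m, n, .last _ _ _ _ => n * (m + 1)
  | m, _, .layer (l := l) _ _ _ Φ => l * (m + 1) + Φ.params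

/-- The `ℓ_p`-norm on `ℝⁿ`, for `p ∈ [1, ∞]`. -/
noncomputable def lpNorm (p : ℝ≥0∞) {n : ℕ} (x : Fin n → ℝ) : ℝ :=
  ‖(WithLp.toLp p x : PiLp p (fun _ : Fin n => ℝ))‖

/-- The hypercube `[a, b]ᵈ` in `ℝᵈ`. -/
def cube (d : ℕ) (a b : ℝ) : Set (Fin d → ℝ) := {x | ∀ j, x j ∈ Set.Icc a b}

/-- The maximum function `m_d : ℝᵈ → ℝ` (used for `d ≥ 1`). -/
noncomputable def maxFn {d : ℕ} (x : Fin d → ℝ) : ℝ := ⨆ j, x j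

/-- The product function `p_d : ℝᵈ → ℝ`. -/
def prodFn {d : ℕ} (x : Fin d → ℝ) : ℝ := ∏ j, x j

/-- The initial segment of `x` that ends with the entry of index `i`. -/
def initialSegment {d : ℕ} (x : Fin d → ℝ) (i : Fin d) : Fin (i.val + 1) → ℝ :=
  fun j => x (Fin.castLE i.isLt j)

/-- The extended maximum function `x ↦ (m_1(x_1), m_2(x_1, x_2), …, m_d(x_1, …, x_d))`. -/
noncomputable def extMaxFn {d : ℕ} (x : Fin d → ℝ) : Fin d → ℝ :=
  fun i => maxFn (initialSegment x i)

/-- The extended product function `x ↦ (p_1(x_1), p_2(x_1, x_2), …, p_d(x_1, …, x_d))`. -/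
def extProdFn {d : ℕ} (x : Fin d → ℝ) : Fin d → ℝ :=
  fun i => prodFn (initialSegment x i)

/-- For `d = d_1 + ⋯ + d_n`, the `i`-th of the consecutive blocks of lengths `d_1, …, d_n`
of a vector in `ℝᵈ`. -/
def block {n d : ℕ} (ds : Fin n → ℕ) (h : ∑ i, ds i = d) (x : Fin d → ℝ) (i : Fin n) :
    Fin (ds i) → ℝ :=
  fun j => x (Fin.cast h (finSigmaFinEquiv ⟨i, j⟩))

/-- The parallelization `(x_1, …, x_n) ↦ (f_1(x_1), …, f_n(x_n))` of real-valued functions,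
where `x_i` is the `i`-th block of the argument. -/
def parallelization {n d : ℕ} (ds : Fin n → ℕ) (h : ∑ i, ds i = d)
    (f : ∀ i, (Fin (ds i) → ℝ) → ℝ) : (Fin d → ℝ) → (Fin n → ℝ) :=
  fun x i => f i (block ds h x i)

/-! In the classes below, a function on the hypercube `[a, b]ᵈ` is represented by a function on
`ℝᵈ` of which only the values on `[a, b]ᵈ` matter. -/

/-- Parallelizations on `[a, b]ᵈ` of functions of at most `k` variables that are Lipschitz on
their domain with constant `L` for the `ℓ_p`-norm. -/
def parLipschitz (k : ℕ) (p : ℝ≥0∞) (d n : ℕ) (a b L : ℝ) :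
    Set ((Fin d → ℝ) → (Fin n → ℝ)) :=
  {g | ∃ (ds : Fin n → ℕ) (h : ∑ i, ds i = d) (f : ∀ i, (Fin (ds i) → ℝ) → ℝ),
    (∀ i, 1 ≤ ds i ∧ ds i ≤ k) ∧
    (∀ i, ∀ x ∈ cube (ds i) a b, ∀ y ∈ cube (ds i) a b,
      |f i x - f i y| ≤ L * lpNorm p (x - y)) ∧
    Set.EqOn g (parallelization ds h f) (cube d a b)}

/-- Parallelizations on `[a, b]ᵈ` of maximum functions. -/
def parMax (d n : ℕ) (a b : ℝ) : Set ((Fin d → ℝ) → (Fin n → ℝ)) :=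
  {g | ∃ (ds : Fin n → ℕ) (h : ∑ i, ds i = d), (∀ i, 1 ≤ ds i) ∧
    Set.EqOn g (parallelization ds h fun _ => maxFn) (cube d a b)}

/-- Parallelizations on `[a, b]ᵈ` of product functions. -/
def parProd (d n : ℕ) (a b : ℝ) : Set ((Fin d → ℝ) → (Fin n → ℝ)) :=
  {g | ∃ (ds : Fin n → ℕ) (h : ∑ i, ds i = d), (∀ i, 1 ≤ ds i) ∧
    Set.EqOn g (parallelization ds h fun _ => prodFn) (cube d a b)}

/-- The functions that agree on `[a, b]ᵈ` with the extended maximum (which forces the output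
dimension `n` to be `d`). -/
def extMax (d n : ℕ) (a b : ℝ) : Set ((Fin d → ℝ) → (Fin n → ℝ)) :=
  {g | ∃ h : n = d, ∀ x ∈ cube d a b, ∀ j, g x j = extMaxFn x (Fin.cast h j)}

/-- The functions that agree on `[a, b]ᵈ` with the extended product (which forces the output
dimension `n` to be `d`). -/
def extProd (d n : ℕ) (a b : ℝ) : Set ((Fin d → ℝ) → (Fin n → ℝ)) :=
  {g | ∃ h : n = d, ∀ x ∈ cube d a b, ∀ j, g x j = extProdFn x (Fin.cast h j)}

/-- The composition `g_k ∘ g_{k-1} ∘ ⋯ ∘ g_1`, where `g_i` maps `ℝ^{D_i}` to `ℝ^{D_{i+1}}`. -/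
def compose {D : ℕ → ℕ} (g : ∀ i, (Fin (D i) → ℝ) → (Fin (D (i + 1)) → ℝ)) :
    (k : ℕ) → (Fin (D 1) → ℝ) → (Fin (D (k + 1)) → ℝ)
  | 0 => id
  | k + 1 => g (k + 1) ∘ compose g k

end ReLUApprox

open ReLUApprox

/-! Put `M = c d ^ c`. Every factor `g d i` is Lipschitz in the sup norm with constant `c M`, and
each coordinate of it is a Lipschitz function of at most `c` variables, a maximum or a product. With
a resolution `N`, each coordinate has a network of width `O(M N ^ c)` and depth `O(M)` with error
`O(M ^ 2 / N)`. Lipschitz functions are interpolated piecewise linearly on a grid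
(`netApprox_of_lipschitz`). Maxima are exact. Products iterate an approximate multiplication
obtained from an interpolated square (`exists_net_mul`); its width is linear in `N`, which `N ^ c`
dominates, so no faster rate is needed.

In the composition (`exists_net_compose`) every intermediate value is clamped to the next cube,
where the next approximation is valid. Errors are then amplified only by the Lipschitz constants, at
most `(c M) ^ k`, which is polynomial in `d` because `k` is fixed. So `N` can be a polynomial in `d`
times `1 / ε`. The parameter count is about depth times width squared, whence `ε ^ (-2c)`. -/

namespace ReLUApprox

/-! ### Calculus of networks of bounded width -/

/-- `IsNet w Y L X f` says that `f : X → Y` is an alternating composition of affine maps and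
`L` ReLU activations, all of whose hidden layers have between `1` and `w` neurons. -/
def IsNet (w : ℕ) (Y : Type) [AddCommGroup Y] [Module ℝ Y] :
    ℕ → ∀ (X : Type) [AddCommGroup X] [Module ℝ X], (X → Y) → Prop
  | 0, X, _, _, f => ∃ A : X →ᵃ[ℝ] Y, ∀ x, f x = A x
  | L + 1, X, _, _, f => ∃ (κ : Type) (_ : Fintype κ) (A : X →ᵃ[ℝ] (κ → ℝ)) (h : (κ → ℝ) → Y),
      Nonempty κ ∧ Fintype.card κ ≤ w ∧ IsNet w Y L (κ → ℝ) h ∧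
      ∀ x, f x = h (fun i => max (A x i) 0)

namespace IsNet

variable {X Y Z : Type} [AddCommGroup X] [Module ℝ X] [AddCommGroup Y] [Module ℝ Y]
  [AddCommGroup Z] [Module ℝ Z]

theorem mono {w w' : ℕ} (hw : w ≤ w') {L : ℕ} {f : X → Y} (hf : IsNet w Y L X f) :
    IsNet w' Y L X f := by
  induction L generalizing X with
  | zero => exact hf
  | succ L ih =>
    obtain ⟨κ, _, A, h, hne, hc, hh, hfx⟩ := hf
    exact ⟨κ, _, A, h, hne, hc.trans hw, ih hh, hfx⟩

theorem affine (w : ℕ) (A : X →ᵃ[ℝ] Y) : IsNet w Y 0 X A := ⟨A, fun _ => rfl⟩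

theorem apply {J : Type} (w : ℕ) (j : J) : IsNet w ℝ 0 (J → ℝ) (fun x => x j) :=
  ⟨(LinearMap.proj j).toAffineMap, fun _ => rfl⟩

theorem comp_affine {w L : ℕ} {f : Y → Z} (hf : IsNet w Z L Y f) (A : X →ᵃ[ℝ] Y) :
    IsNet w Z L X (fun x => f (A x)) := by
  cases L with
  | zero =>
    obtain ⟨B, hB⟩ := hf
    exact ⟨B.comp A, fun x => by simp [hB]⟩
  | succ L =>
    obtain ⟨κ, _, B, h, hne, hc, hh, hfx⟩ := hf
    exact ⟨κ, _, B.comp A, h, hne, hc, hh, fun x => by simp [hfx]⟩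

theorem comp {w L L' : ℕ} {g : Y → Z} {f : X → Y} (hg : IsNet w Z L' Y g)
    (hf : IsNet w Y L X f) : IsNet w Z (L' + L) X (fun x => g (f x)) := by
  induction L generalizing X with
  | zero =>
    obtain ⟨A, hA⟩ := hf
    simpa only [hA, Nat.add_zero] using hg.comp_affine A
  | succ L ih =>
    obtain ⟨κ, _, A, h, hne, hc, hh, hfx⟩ := hf
    exact ⟨κ, _, A, _, hne, hc, ih hh, fun x => by simp [hfx]⟩

theorem affine_comp {w L : ℕ} (A : Y →ᵃ[ℝ] Z) {f : X → Y} (hf : IsNet w Y L X f) :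
    IsNet w Z L X (fun x => A (f x)) := by
  simpa using (affine w A).comp hf

/-- Networks of equal depth run side by side: the hidden layers are disjoint unions, so widths add,
and each network reads only its own summand. -/
theorem pi {J : Type} [Fintype J] [Nonempty J] {w : J → ℕ} {L : ℕ} {f : J → X → ℝ}
    (hf : ∀ j, IsNet (w j) ℝ L X (f j)) :
    IsNet (∑ j, w j) (J → ℝ) L X (fun x j => f j x) := by
  induction L generalizing X with
  | zero =>
    choose A hA using hf
    exact ⟨AffineMap.pi A, fun x => by ext j; simp [hA]⟩
  | succ L ih =>
    choose κ hκ A h hne hc hh hfx using hf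
    refine ⟨Σ j, κ j, inferInstance,
      AffineMap.pi fun p => (AffineMap.proj (k := ℝ) p.2).comp (A p.1),
      fun z j => h j (fun i => z ⟨j, i⟩), ⟨Classical.arbitrary J, Classical.arbitrary _⟩, ?_, ?_, ?_⟩
    · rw [Fintype.card_sigma]
      exact Finset.sum_le_sum fun j _ => hc j
    · refine ih fun j => ?_
      exact (hh j).comp_affine (LinearMap.funLeft ℝ ℝ (fun i => (⟨j, i⟩ : Σ j, κ j))).toAffineMap
    · intro x
      ext j
      simp [hfx]

theorem pi_const {J : Type} [Fintype J] [Nonempty J] {w : ℕ} {L : ℕ} {f : J → X → ℝ}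
    (hf : ∀ j, IsNet w ℝ L X (f j)) :
    IsNet (Fintype.card J * w) (J → ℝ) L X (fun x j => f j x) := by
  simpa using pi hf

theorem sum_mul {J : Type} [Fintype J] [Nonempty J] {w : ℕ} {L : ℕ} {f : J → X → ℝ}
    (hf : ∀ j, IsNet w ℝ L X (f j)) (a : J → ℝ) :
    IsNet (Fintype.card J * w) ℝ L X (fun x => ∑ j, a j * f j x) := by
  have := affine_comp (∑ j, a j • LinearMap.proj (R := ℝ) (φ := fun _ : J => ℝ) j).toAffineMap
    (pi_const hf)
  simpa using this

theorem sub {w L : ℕ} {f g : X → ℝ} (hf : IsNet w ℝ L X f) (hg : IsNet w ℝ L X g) :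
    IsNet (2 * w) ℝ L X (fun x => f x - g x) := by
  have := sum_mul (J := Bool) (f := fun j => if j then f else g)
    (by rintro (_ | _) <;> simpa) (fun j => if j then 1 else -1)
  simpa [sub_eq_add_neg] using this

theorem relu {w L : ℕ} (hw : 1 ≤ w) {f : X → ℝ} (hf : IsNet w ℝ L X f) :
    IsNet w ℝ (L + 1) X (fun x => max (f x) 0) := by
  have h : IsNet w ℝ 1 ℝ (fun t => max t 0) :=
    ⟨Unit, inferInstance, AffineMap.pi fun _ => AffineMap.id ℝ ℝ, fun z => z (), inferInstance,
      by simpa, ⟨(LinearMap.proj ()).toAffineMap, fun _ => by simp⟩, fun x => by simp⟩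
  rw [add_comm]
  exact h.comp hf

/-- Two neurons carry a value through a layer, since `t = max t 0 - max (-t) 0`. This lets networks
of different depths be aligned. -/
theorem id_real {w : ℕ} (hw : 2 ≤ w) (L : ℕ) : IsNet w ℝ L ℝ (fun t => t) := by
  induction L with
  | zero => exact affine w (AffineMap.id ℝ ℝ)
  | succ L ih =>
    have h := (((affine 1 (AffineMap.id ℝ ℝ)).relu le_rfl).sub
      ((affine 1 (-AffineMap.id ℝ ℝ)).relu le_rfl)).mono hw
    have := ih.comp h
    convert this using 2 with t
    simp only [AffineMap.id_apply, AffineMap.coe_neg, Pi.neg_apply]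
    rcases le_total t 0 with h | h
    · rw [max_eq_right h, max_eq_left (by linarith)]; ring
    · rw [max_eq_left h, max_eq_right (by linarith)]; ring

theorem deepen {w L L' : ℕ} (hw : 2 ≤ w) (hL : L ≤ L') {f : X → ℝ} (hf : IsNet w ℝ L X f) :
    IsNet w ℝ L' X f := by
  obtain ⟨t, rfl⟩ := Nat.exists_eq_add_of_le hL
  rw [add_comm]
  exact (id_real hw t).comp hf

theorem exists_network {w L m n : ℕ} (hm : 0 < m) (hn : 0 < n) (hmw : m ≤ w) (hnw : n ≤ w)
    {f : (Fin m → ℝ) → (Fin n → ℝ)} (hf : IsNet w (Fin n → ℝ) L (Fin m → ℝ) f) :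
    ∃ Φ : Network m n, Φ.realize = f ∧ Φ.params ≤ (L + 1) * (w * (w + 1)) := by
  have hA : ∀ {m l : ℕ} (A : (Fin m → ℝ) →ᵃ[ℝ] (Fin l → ℝ)) (x : Fin m → ℝ),
      LinearMap.toMatrix' A.linear *ᵥ x + A 0 = A x := by
    intro m l A x
    rw [← Matrix.toLin'_apply, Matrix.toLin'_toMatrix']
    simpa using (A.map_vadd 0 x).symm
  induction L generalizing m with
  | zero =>
    obtain ⟨A, h⟩ := hf
    refine ⟨.last hm hn (LinearMap.toMatrix' A.linear) (A 0), ?_, ?_⟩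
    · ext1 x
      rw [Network.realize, hA, h]
    · simp only [Network.params]
      nlinarith [Nat.mul_le_mul hnw (Nat.add_le_add_right hmw 1)]
  | succ L ih =>
    obtain ⟨κ, _, A, h, hne, hc, hh, hfx⟩ := hf
    let e := Fintype.equivFin κ
    obtain ⟨Φ, hΦ, hp⟩ := ih Fintype.card_pos hc
      (hh.comp_affine (LinearMap.funLeft ℝ ℝ e).toAffineMap)
    let B : (Fin m → ℝ) →ᵃ[ℝ] (Fin (Fintype.card κ) → ℝ) :=
      (LinearMap.funLeft ℝ ℝ e.symm).toAffineMap.comp A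
    refine ⟨.layer hm (LinearMap.toMatrix' B.linear) (B 0) Φ, ?_, ?_⟩
    · ext1 x
      rw [Network.realize, hA, hΦ, hfx]
      dsimp only
      congr 1
      ext i
      simp [B, LinearMap.funLeft_apply, ReLUApprox.relu]
    · simp only [Network.params]
      nlinarith [Nat.mul_le_mul hc (Nat.add_le_add_right hmw 1)]

end IsNet

theorem Network.continuous_realize {m n : ℕ} (Φ : Network m n) : Continuous Φ.realize := by
  induction Φ with
  | last hm hn W b =>
    simp only [Network.realize]
    exact (Continuous.matrix_mulVec continuous_const continuous_id).add continuous_const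
  | layer hm W b Φ ih =>
    simp only [Network.realize]
    refine ih.comp (continuous_pi fun i => ?_)
    simp only [relu]
    exact ((continuous_apply i).comp
      ((Continuous.matrix_mulVec continuous_const continuous_id).add continuous_const)).max
        continuous_const

open MeasureTheory

/-! ### Iterated binary operations and maxima -/

/-- The left fold `op (… op (op x₀ x₁) x₂ …) xₘ`. -/
noncomputable def foldOp (op : ℝ → ℝ → ℝ) : (m : ℕ) → (Fin (m + 1) → ℝ) → ℝ
  | 0, x => x 0
  | m + 1, x => foldOp op m (Fin.cons (op (x 0) (x 1)) fun i => x i.succ.succ)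

/-- Each stage applies `op` to the first two entries while identity networks of the same depth carry
the others along. -/
theorem IsNet.foldOp {w L : ℕ} (hw : 2 ≤ w) {op : ℝ → ℝ → ℝ}
    (hop : IsNet w ℝ L (ℝ × ℝ) (fun q => op q.1 q.2)) (m : ℕ) :
    IsNet ((m + 1) * w) ℝ (m * L) (Fin (m + 1) → ℝ) (foldOp op m) := by
  induction m with
  | zero =>
    rw [zero_mul]
    exact apply _ _
  | succ m ih =>
    have h : IsNet ((m + 1) * w) (Fin (m + 1) → ℝ) L (Fin (m + 2) → ℝ)
        (fun x => Fin.cons (op (x 0) (x 1)) fun i => x i.succ.succ) := by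
      have := pi_const (J := Fin (m + 1)) (w := w) (L := L) (X := Fin (m + 2) → ℝ)
        (f := fun j x => (Fin.cons (op (x 0) (x 1)) fun i => x i.succ.succ : Fin (m + 1) → ℝ) j) ?_
      · simpa using this
      · intro j
        induction j using Fin.cases with
        | zero =>
          simpa using hop.comp_affine ((AffineMap.proj (k := ℝ) (P := fun _ : Fin (m + 2) => ℝ)
            0).prod (AffineMap.proj 1))
        | succ i =>
          simpa using deepen hw (Nat.zero_le L) (apply w i.succ.succ)
    have := (ih.comp h).mono (w' := (m + 1 + 1) * w) (Nat.mul_le_mul_right w (Nat.le_succ _))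
    rwa [← Nat.succ_mul] at this

theorem maxFn_le_iff {m : ℕ} {x : Fin (m + 1) → ℝ} {t : ℝ} : maxFn x ≤ t ↔ ∀ i, x i ≤ t :=
  ciSup_le_iff (Set.finite_range x).bddAbove

theorem le_maxFn {m : ℕ} (x : Fin (m + 1) → ℝ) (i : Fin (m + 1)) : x i ≤ maxFn x :=
  le_ciSup (Set.finite_range x).bddAbove i

theorem maxFn_lt_iff {m : ℕ} {x : Fin (m + 1) → ℝ} {t : ℝ} : maxFn x < t ↔ ∀ i, x i < t := by
  refine ⟨fun h i => (le_maxFn x i).trans_lt h, fun h => ?_⟩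
  obtain ⟨i, hi⟩ := exists_eq_ciSup_of_finite (f := x)
  rw [maxFn, ← hi]
  exact h i

theorem foldOp_max {m : ℕ} (x : Fin (m + 1) → ℝ) : foldOp max m x = maxFn x := by
  induction m with
  | zero =>
    exact le_antisymm (le_maxFn x 0) (maxFn_le_iff.2 fun i => by rw [Fin.fin_one_eq_zero i]; rfl)
  | succ m ih =>
    rw [foldOp, ih]
    refine eq_of_forall_ge_iff fun t => ?_
    simp only [maxFn_le_iff, Fin.forall_fin_succ (n := m), Fin.forall_fin_succ (n := m + 1),
      Fin.cons_zero, Fin.cons_succ, max_le_iff, and_assoc, Fin.succ_zero_eq_one]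

/-- `max x y = x + max (y - x) 0`: one neuron for the difference and two to carry `x`. -/
theorem isNet_max : IsNet 3 ℝ 1 (ℝ × ℝ) (fun q => max q.1 q.2) := by
  have h1 := (IsNet.affine 1 (LinearMap.snd ℝ ℝ ℝ - LinearMap.fst ℝ ℝ ℝ).toAffineMap).relu le_rfl
  have h2 := (IsNet.affine 2 (LinearMap.fst ℝ ℝ ℝ).toAffineMap).deepen le_rfl (Nat.zero_le 1)
  have h := IsNet.affine_comp (LinearMap.proj (R := ℝ) (φ := fun _ : Bool => ℝ) true +
    LinearMap.proj false).toAffineMap (IsNet.pi (J := Bool) (w := fun j => if j then 1 else 2)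
      (X := ℝ × ℝ) (L := 1)
      (f := fun j q => if j then max (q.2 - q.1) 0 else q.1)
      (by rintro (_ | _) <;> simpa))
  have e : ∑ j : Bool, (if j then 1 else 2 : ℕ) = 3 := rfl
  rw [e] at h
  convert h using 2 with q
  simp [← max_add_add_right, max_comm]

theorem isNet_maxFn (m : ℕ) : IsNet ((m + 1) * 3) ℝ m (Fin (m + 1) → ℝ) maxFn := by
  have := isNet_max.foldOp (by norm_num) m
  rw [mul_one] at this
  convert this using 1
  ext x
  exact (foldOp_max x).symm

theorem abs_maxFn_sub_le {m : ℕ} (x y : Fin (m + 1) → ℝ) : |maxFn x - maxFn y| ≤ ‖x - y‖ := by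
  have key : ∀ x y : Fin (m + 1) → ℝ, maxFn x ≤ maxFn y + ‖x - y‖ := by
    intro x y
    refine maxFn_le_iff.2 fun i => ?_
    have h1 := norm_le_pi_norm (x - y) i
    have h2 := le_maxFn y i
    rw [Pi.sub_apply, Real.norm_eq_abs] at h1
    linarith [le_abs_self (x i - y i)]
  have h1 := key x y
  have h2 := key y x
  rw [norm_sub_rev] at h2
  rw [abs_le]
  constructor <;> linarith

/-! ### Kuhn hat functions as a partition of unity -/

/-- The nodal function at the origin of the piecewise linear interpolation on the Kuhn
triangulation of the integer lattice. -/
noncomputable def kuhnHat {m : ℕ} (u : Fin m → ℝ) : ℝ :=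
  max (-maxFn (Fin.cons (-1) (fun i => -u i - 1) : Fin (m + 1) → ℝ) -
    maxFn (Fin.cons 0 u : Fin (m + 1) → ℝ)) 0

/-- The set of all `t ∈ (0, 1]` with `⌈t - u i⌉ = 1` for all `i`; its length is `kuhnHat u`. -/
def kuhnSet {m : ℕ} (u : Fin m → ℝ) : Set ℝ := Set.Ioc 0 1 ∩ ⋂ i, Set.Ioc (u i) (u i + 1)

theorem mem_kuhnSet {m : ℕ} {u : Fin m → ℝ} {t : ℝ} :
    t ∈ kuhnSet u ↔ t ∈ Set.Ioc 0 1 ∧ ∀ i, t ∈ Set.Ioc (u i) (u i + 1) := by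
  rw [kuhnSet, Set.mem_inter_iff, Set.mem_iInter]

/-- An intersection of intervals runs from the largest left endpoint to the smallest right one; the
minimum is written as minus a maximum so that `maxFn` suffices. -/
theorem kuhnSet_eq_Ioc {m : ℕ} (u : Fin m → ℝ) :
    kuhnSet u = Set.Ioc (maxFn (Fin.cons 0 u : Fin (m + 1) → ℝ))
      (-maxFn (Fin.cons (-1) (fun i => -u i - 1) : Fin (m + 1) → ℝ)) := by
  ext t
  rw [mem_kuhnSet, Set.mem_Ioc (a := maxFn _), le_neg, maxFn_lt_iff, maxFn_le_iff]
  simp only [Fin.forall_fin_succ, Fin.cons_zero, Fin.cons_succ, Set.mem_Ioc, neg_le_neg_iff,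
    forall_and]
  have : ∀ i, -u i - 1 ≤ -t ↔ t ≤ u i + 1 := fun i => by constructor <;> intro h <;> linarith
  simp only [this]
  tauto

theorem kuhnHat_eq_measureReal {m : ℕ} (u : Fin m → ℝ) :
    kuhnHat u = volume.real (kuhnSet u) := by
  rw [kuhnSet_eq_Ioc, measureReal_def, Real.volume_Ioc, ENNReal.toReal_ofReal', kuhnHat]

theorem kuhnHat_nonneg {m : ℕ} (u : Fin m → ℝ) : 0 ≤ kuhnHat u := le_max_right _ _

theorem abs_le_one_of_kuhnHat_ne_zero {m : ℕ} {u : Fin m → ℝ} (h : kuhnHat u ≠ 0) (i : Fin m) :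
    |u i| ≤ 1 := by
  rw [kuhnHat_eq_measureReal] at h
  obtain ⟨t, h⟩ := nonempty_of_measureReal_ne_zero h
  obtain ⟨ht, hu⟩ := mem_kuhnSet.1 h
  have := hu i
  rw [Set.mem_Ioc] at this ht
  rw [abs_le]
  constructor <;> linarith

/-- The sets `kuhnSet (s - z)` partition `(0, 1]`: the point `t` lies in exactly the one with `z i =
⌊s i - t + 1⌋`. Their lengths therefore add up to 1. -/
theorem sum_kuhnHat {m N : ℕ} {s : Fin m → ℝ} (hs : ∀ i, s i ∈ Set.Icc (0 : ℝ) N) :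
    ∑ z : Fin m → Fin (N + 1), kuhnHat (fun i => s i - (z i : ℕ)) = 1 := by
  simp only [kuhnHat_eq_measureReal]
  have hfin : ∀ z : Fin m → Fin (N + 1),
      volume (kuhnSet fun i => s i - ((z i : ℕ) : ℝ)) ≠ ⊤ := fun z => by
    rw [kuhnSet_eq_Ioc]
    exact measure_Ioc_lt_top.ne
  rw [← measureReal_biUnion_finset (h := fun z _ => hfin z)]
  · have : (⋃ z ∈ (Finset.univ : Finset (Fin m → Fin (N + 1))),
        kuhnSet fun i => s i - ((z i : ℕ) : ℝ)) = Set.Ioc 0 1 := by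
      ext t
      simp only [Finset.mem_univ, Set.iUnion_true, Set.mem_iUnion, mem_kuhnSet]
      refine ⟨fun ⟨_, h, _⟩ => h, fun ht => ?_⟩
      have hz : ∀ i, ∃ z : Fin (N + 1), t ∈ Set.Ioc (s i - ((z : ℕ) : ℝ))
          (s i - ((z : ℕ) : ℝ) + 1) := by
        intro i
        obtain ⟨h0, h1⟩ := ht
        obtain ⟨h2, h3⟩ := hs i
        -- The bounds `0 < t ≤ 1` keep the floor within `{0, …, N}`.
        have h4 : 0 ≤ s i - t + 1 := by linarith
        have h5 := Nat.floor_le h4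
        have h6 := Nat.lt_floor_add_one (s i - t + 1)
        refine ⟨⟨⌊s i - t + 1⌋₊, ?_⟩, ?_⟩
        · have : (⌊s i - t + 1⌋₊ : ℝ) < (N + 1 : ℕ) := by push_cast; linarith
          exact_mod_cast this
        · dsimp only
          constructor <;> linarith
      choose z hz using hz
      exact ⟨z, ht, hz⟩
    rw [this]
    simp [measureReal_def]
  · intro z _ z' _ hne
    refine Set.disjoint_left.2 fun t ht ht' => hne ?_
    ext i
    have h1 := (mem_kuhnSet.1 ht).2 i
    have h2 := (mem_kuhnSet.1 ht').2 i
    rw [Set.mem_Ioc] at h1 h2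
    have h3 : ((z i : ℕ) : ℝ) < (z' i : ℕ) + 1 := by linarith
    have h4 : ((z' i : ℕ) : ℝ) < (z i : ℕ) + 1 := by linarith
    norm_cast at h3 h4
    omega
  · exact fun z _ => by rw [kuhnSet_eq_Ioc]; exact measurableSet_Ioc

theorem isNet_kuhnHat (m : ℕ) :
    IsNet (6 * (m + 1)) ℝ (m + 1) (Fin m → ℝ) kuhnHat := by
  let A : (Fin m → ℝ) →ᵃ[ℝ] (Fin (m + 1) → ℝ) := AffineMap.pi
    (Fin.cons (AffineMap.const ℝ _ (-1))
      fun i => -(AffineMap.proj (k := ℝ) (P := fun _ : Fin m => ℝ) i) - AffineMap.const ℝ _ 1)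
  let B : (Fin m → ℝ) →ᵃ[ℝ] (Fin (m + 1) → ℝ) := AffineMap.pi
    (Fin.cons (AffineMap.const ℝ _ 0)
      fun i => (AffineMap.proj (k := ℝ) (P := fun _ : Fin m => ℝ) i))
  have hA : ∀ u, A u = Fin.cons (-1) (fun i => -u i - 1) := by
    intro u
    ext i
    induction i using Fin.cases <;> simp [A]
  have hB : ∀ u, B u = Fin.cons 0 u := by
    intro u
    ext i
    induction i using Fin.cases <;> simp [B]
  have h := IsNet.sub (f := fun u => -maxFn (A u))
    (IsNet.affine_comp (-AffineMap.id ℝ ℝ) ((isNet_maxFn m).comp_affine A))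
    ((isNet_maxFn m).comp_affine B)
  have := (h.mono (w' := 6 * (m + 1)) (by omega)).relu (by omega)
  simp only [hA, hB] at this
  exact this

/-! ### Interpolation of Lipschitz functions -/

/-- A function on `S` that is Lipschitz with constant `Λ` and that some network with `L` hidden
layers of width at most `w` approximates up to an error of `δ`. -/
def NetApprox {X Y : Type} [NormedAddCommGroup X] [NormedSpace ℝ X] [NormedAddCommGroup Y]
    [NormedSpace ℝ Y] (S : Set X) (Λ δ : ℝ) (w L : ℕ) (h : X → Y) : Prop :=
  (∀ x ∈ S, ∀ y ∈ S, ‖h x - h y‖ ≤ Λ * ‖x - y‖) ∧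
    ∃ f, IsNet w Y L X f ∧ ∀ x ∈ S, ‖f x - h x‖ ≤ δ

/-- The hats are nonnegative, sum to 1, and vanish unless the node is within one mesh width of `x`
in every coordinate. The interpolant is thus a convex combination of values within `Λ` times the
mesh of `f x`. -/
theorem netApprox_of_lipschitz {m N : ℕ} (hN : 1 ≤ N) {a b Λ : ℝ} (hab : a < b) (hΛ : 0 ≤ Λ)
    {f : (Fin m → ℝ) → ℝ}
    (hf : ∀ x ∈ cube m a b, ∀ y ∈ cube m a b, ‖f x - f y‖ ≤ Λ * ‖x - y‖) :
    NetApprox (cube m a b) Λ (Λ * ((b - a) / N)) ((N + 1) ^ m * (6 * (m + 1))) (m + 1) f := by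
  refine ⟨hf, ?_⟩
  have hba : 0 < b - a := sub_pos.2 hab
  have hN' : (0 : ℝ) < N := by exact_mod_cast hN
  let pt : (Fin m → Fin (N + 1)) → (Fin m → ℝ) := fun z i => a + (z i : ℕ) * ((b - a) / N)
  have hpt : ∀ z, pt z ∈ cube m a b := by
    intro z i
    have h1 : ((z i : ℕ) : ℝ) ≤ N := by exact_mod_cast Nat.lt_succ_iff.1 (z i).2
    have h2 : ((z i : ℕ) : ℝ) * ((b - a) / N) ≤ N * ((b - a) / N) := by gcongr
    rw [mul_div_cancel₀ _ hN'.ne'] at h2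
    have h3 : 0 ≤ ((z i : ℕ) : ℝ) * ((b - a) / N) := by positivity
    constructor <;> simp only [pt] <;> linarith
  let A : (Fin m → Fin (N + 1)) → (Fin m → ℝ) →ᵃ[ℝ] (Fin m → ℝ) := fun z =>
    AffineMap.pi fun i => (N / (b - a)) • ((AffineMap.proj (k := ℝ) (P := fun _ : Fin m => ℝ) i) -
      AffineMap.const ℝ _ a) - AffineMap.const ℝ _ ((z i : ℕ) : ℝ)
  have hA : ∀ z x, A z x = fun i => N / (b - a) * (x i - a) - ((z i : ℕ) : ℝ) := by
    intro z x
    ext i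
    simp [A]
  refine ⟨fun x => ∑ z, f (pt z) * kuhnHat (A z x), ?_, fun x hx => ?_⟩
  · have := IsNet.sum_mul (fun z => (isNet_kuhnHat m).comp_affine (A z)) (fun z => f (pt z))
    simpa using this
  · have hsum : ∑ z, kuhnHat (A z x) = 1 := by
      simp only [hA]
      refine sum_kuhnHat fun i => ?_
      obtain ⟨h1, h2⟩ := hx i
      constructor
      · exact mul_nonneg (by positivity) (by linarith)
      · rw [div_mul_eq_mul_div, div_le_iff₀ hba]
        gcongr
    have e : ∑ z, f (pt z) * kuhnHat (A z x) - f x =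
        ∑ z, (f (pt z) - f x) * kuhnHat (A z x) := by
      simp only [sub_mul, Finset.sum_sub_distrib, ← Finset.mul_sum, hsum, mul_one]
    rw [e]
    calc ‖∑ z, (f (pt z) - f x) * kuhnHat (A z x)‖
        ≤ ∑ z, ‖(f (pt z) - f x) * kuhnHat (A z x)‖ := norm_sum_le _ _
      _ ≤ ∑ z, (Λ * ((b - a) / N)) * kuhnHat (A z x) := by
          refine Finset.sum_le_sum fun z _ => ?_
          rw [norm_mul, Real.norm_of_nonneg (kuhnHat_nonneg _)]
          rcases eq_or_ne (kuhnHat (A z x)) 0 with h0 | h0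
          · simp [h0]
          refine mul_le_mul_of_nonneg_right ?_ (kuhnHat_nonneg _)
          refine (hf _ (hpt z) _ hx).trans (mul_le_mul_of_nonneg_left ?_ hΛ)
          refine (pi_norm_le_iff_of_nonneg (by positivity)).2 fun i => ?_
          have := abs_le_one_of_kuhnHat_ne_zero h0 i
          rw [hA] at this
          have e2 : (pt z - x) i =
              -((N / (b - a) * (x i - a) - ((z i : ℕ) : ℝ)) * ((b - a) / N)) := by
            simp only [pt, Pi.sub_apply]
            field_simp
            ring
          rw [e2, norm_neg, norm_mul, Real.norm_eq_abs,
            Real.norm_of_nonneg (by positivity : 0 ≤ (b - a) / N)]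
          exact mul_le_of_le_one_left (by positivity) this
      _ = Λ * ((b - a) / N) := by rw [← Finset.mul_sum, hsum, mul_one]

/-! ### Clamping and products -/

/-- The clamp equals `a + max (t - a) 0 - max (t - b) 0`. -/
theorem isNet_clamp {a b : ℝ} (hab : a ≤ b) :
    IsNet 2 ℝ 1 ℝ (fun t => max a (min b t)) := by
  have h := IsNet.affine_comp (AffineMap.id ℝ ℝ + AffineMap.const ℝ ℝ a) <|
    ((IsNet.affine 1 (AffineMap.id ℝ ℝ - AffineMap.const ℝ ℝ a)).relu le_rfl).sub
    ((IsNet.affine 1 (AffineMap.id ℝ ℝ - AffineMap.const ℝ ℝ b)).relu le_rfl)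
  convert h using 2 with t
  simp only [AffineMap.coe_add, AffineMap.coe_sub, AffineMap.coe_id, AffineMap.coe_const,
    Pi.add_apply, Pi.sub_apply, id, Function.const_apply]
  rcases le_total t a with h1 | h1 <;> rcases le_total t b with h2 | h2 <;>
    simp [h1, h2, hab]
  linarith

theorem abs_clamp_sub_le {a b t s : ℝ} (hs : s ∈ Set.Icc a b) :
    |max a (min b t) - s| ≤ |t - s| := by
  have h1 := abs_max_sub_max_le_max a (min b t) a (min b s)
  have h2 := abs_min_sub_min_le_max b t b s
  rw [sub_self, abs_zero, max_eq_right (a := (0 : ℝ)) (abs_nonneg _)] at h1 h2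
  rw [min_eq_right hs.2, max_eq_right hs.1] at h1
  rw [min_eq_right hs.2] at h2
  exact h1.trans h2

/-- Polarization: `x * y = ((x + y) / 2) ^ 2 - ((x - y) / 2) ^ 2`. The square is 2-Lipschitz on
`[-1, 1]` and the mesh is `2 / N`, so each square costs `4 / N`. Clamping to `[-1, 1]` does not
increase the error and lets the output be multiplied again. -/
theorem exists_net_mul {N : ℕ} (hN : 1 ≤ N) :
    ∃ op : ℝ → ℝ → ℝ, IsNet (24 * (N + 1)) ℝ 3 (ℝ × ℝ) (fun q => op q.1 q.2) ∧
      ∀ x y, |x| ≤ 1 → |y| ≤ 1 → |op x y| ≤ 1 ∧ |op x y - x * y| ≤ 8 / N := by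
  obtain ⟨-, f, hf, hfx⟩ := netApprox_of_lipschitz (m := 1) hN (a := -1) (b := 1) (Λ := 2)
    (by norm_num) (by norm_num) (f := fun x => x 0 ^ 2) (by
      intro x hx y hy
      have h1 := norm_le_pi_norm (x - y) 0
      rw [Pi.sub_apply] at h1
      rw [sq_sub_sq, norm_mul]
      refine mul_le_mul ?_ h1 (norm_nonneg _) (by norm_num)
      rw [Real.norm_eq_abs, abs_le]
      obtain ⟨h1, h2⟩ := hx 0
      obtain ⟨h3, h4⟩ := hy 0
      constructor <;> linarith)
  let A : (ℝ × ℝ) →ₗ[ℝ] (Fin 1 → ℝ) :=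
    LinearMap.pi fun _ => (1 / 2 : ℝ) • (LinearMap.fst ℝ ℝ ℝ + LinearMap.snd ℝ ℝ ℝ)
  let B : (ℝ × ℝ) →ₗ[ℝ] (Fin 1 → ℝ) :=
    LinearMap.pi fun _ => (1 / 2 : ℝ) • (LinearMap.fst ℝ ℝ ℝ - LinearMap.snd ℝ ℝ ℝ)
  refine ⟨fun x y => max (-1) (min 1 (f (A (x, y)) - f (B (x, y)))), ?_, fun x y hx hy => ?_⟩
  · have h := ((isNet_clamp (by norm_num : (-1 : ℝ) ≤ 1)).mono (by omega)).comp
      (((hf.comp_affine A.toAffineMap).sub (hf.comp_affine B.toAffineMap)).mono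
        (w' := 24 * (N + 1)) (by rw [pow_one]; omega))
    exact h
  · rw [abs_le] at hx hy
    refine ⟨abs_le.2 ⟨le_max_left _ _, max_le (by norm_num) (min_le_left _ _)⟩, ?_⟩
    have hxy : x * y ∈ Set.Icc (-1 : ℝ) 1 := by
      rw [Set.mem_Icc, ← abs_le, abs_mul]
      exact mul_le_one₀ (abs_le.2 hx) (abs_nonneg _) (abs_le.2 hy)
    refine (abs_clamp_sub_le hxy).trans ?_
    have h1 := hfx (A (x, y)) fun i => by
      constructor <;> simp [A] <;> linarith
    have h2 := hfx (B (x, y)) fun i => by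
      constructor <;> simp [B] <;> linarith
    have e : x * y = (A (x, y) 0) ^ 2 - (B (x, y) 0) ^ 2 := by simp [A, B]; ring
    rw [e]
    rw [Real.norm_eq_abs, abs_le] at h1 h2
    have e2 : (8 : ℝ) / N = 2 * (2 * ((1 - -1) / N)) := by ring
    rw [e2, abs_le]
    constructor <;> linarith

theorem prodFn_cons {m : ℕ} (x : Fin (m + 1) → ℝ) :
    prodFn x = x 0 * prodFn (fun i : Fin m => x i.succ) := Fin.prod_univ_succ x

theorem abs_prodFn_le_one {m : ℕ} {x : Fin m → ℝ} (hx : ∀ i, |x i| ≤ 1) : |prodFn x| ≤ 1 := by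
  rw [prodFn, Finset.abs_prod]
  exact Finset.prod_le_one (fun _ _ => abs_nonneg _) fun i _ => hx i

theorem abs_prodFn_sub_le {m : ℕ} {x y : Fin m → ℝ} (hx : ∀ i, |x i| ≤ 1) (hy : ∀ i, |y i| ≤ 1)
    {r : ℝ} (hr : ∀ i, |x i - y i| ≤ r) : |prodFn x - prodFn y| ≤ m * r := by
  induction m with
  | zero => simp [prodFn]
  | succ m ih =>
    have h := ih (x := fun i => x i.succ) (y := fun i => y i.succ) (fun i => hx _)
      (fun i => hy _) (fun i => hr _)
    have hy' := abs_prodFn_le_one (x := fun i : Fin m => y i.succ) fun i => hy _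
    rw [prodFn_cons, prodFn_cons]
    set P := prodFn fun i : Fin m => x i.succ
    set Q := prodFn fun i : Fin m => y i.succ
    calc |x 0 * P - y 0 * Q| = |x 0 * (P - Q) + (x 0 - y 0) * Q| := by congr 1; ring
      _ ≤ |x 0| * |P - Q| + |x 0 - y 0| * |Q| := by
          rw [← abs_mul, ← abs_mul]; exact abs_add_le _ _
      _ ≤ 1 * (m * r) + r * 1 :=
          add_le_add (mul_le_mul (hx 0) h (abs_nonneg _) zero_le_one)
            (mul_le_mul (hr 0) hy' (abs_nonneg _) ((abs_nonneg _).trans (hr 0)))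
      _ = ((m + 1 : ℕ) : ℝ) * r := by push_cast; ring

/-- Each multiplication adds at most `η`, because the remaining factors have product at most 1 in
absolute value. -/
theorem abs_foldOp_sub_prodFn_le {op : ℝ → ℝ → ℝ} {η : ℝ}
    (hop : ∀ x y, |x| ≤ 1 → |y| ≤ 1 → |op x y| ≤ 1 ∧ |op x y - x * y| ≤ η) {m : ℕ}
    {x : Fin (m + 1) → ℝ} (hx : ∀ i, |x i| ≤ 1) : |foldOp op m x - prodFn x| ≤ m * η := by
  induction m with
  | zero => simp [foldOp, prodFn]
  | succ m ih =>
    obtain ⟨h1, h2⟩ := hop (x 0) (x 1) (hx 0) (hx 1)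
    have h := ih (x := Fin.cons (op (x 0) (x 1)) fun i => x i.succ.succ) (by
      intro i
      induction i using Fin.cases with
      | zero => simpa using h1
      | succ i => simpa using hx _)
    have hP := abs_prodFn_le_one (x := fun i : Fin m => x i.succ.succ) fun i => hx _
    rw [prodFn_cons] at h
    rw [foldOp, prodFn_cons, prodFn_cons]
    simp only [Fin.cons_zero, Fin.cons_succ, Fin.succ_zero_eq_one] at h ⊢
    set P := prodFn fun i : Fin m => x i.succ.succ
    calc _ ≤ |foldOp op m (Fin.cons (op (x 0) (x 1)) fun i => x i.succ.succ) -
            op (x 0) (x 1) * P| + |op (x 0) (x 1) * P - x 0 * (x 1 * P)| := abs_sub_le _ _ _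
      _ ≤ m * η + η * 1 := by
          refine add_le_add h ?_
          rw [← mul_assoc, ← sub_mul, abs_mul]
          exact mul_le_mul h2 hP (abs_nonneg _) ((abs_nonneg _).trans h2)
      _ = ((m + 1 : ℕ) : ℝ) * η := by push_cast; ring

theorem netApprox_prodFn {m N : ℕ} (hN : 1 ≤ N) {a b : ℝ} (ha : -1 ≤ a) (hb : b ≤ 1) :
    NetApprox (cube (m + 1) a b) (m + 1 : ℕ) (m * (8 / N)) ((m + 1) * (24 * (N + 1))) (m * 3)
      prodFn := by
  have hcube : ∀ x ∈ cube (m + 1) a b, ∀ i, |x i| ≤ 1 := fun x hx i =>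
    abs_le.2 ⟨ha.trans (hx i).1, (hx i).2.trans hb⟩
  obtain ⟨op, hop, hop'⟩ := exists_net_mul hN
  exact ⟨fun x hx y hy => abs_prodFn_sub_le (hcube x hx) (hcube y hy)
      fun i => norm_le_pi_norm (x - y) i,
    foldOp op m, hop.foldOp (by omega) m,
    fun x hx => abs_foldOp_sub_prodFn_le hop' (hcube x hx)⟩

theorem netApprox_maxFn {m : ℕ} (S : Set (Fin (m + 1) → ℝ)) :
    NetApprox S 1 0 ((m + 1) * 3) m maxFn :=
  ⟨fun x _ y _ => by simpa using abs_maxFn_sub_le x y, maxFn, isNet_maxFn m, fun x _ => by simp⟩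

/-! ### Approximation of the building blocks -/

/-- The comparison factor is `m ^ (1 / p)`, with exponent at most 1. It allows all estimates to be
made in the sup norm. -/
theorem lpNorm_le {p : ℝ≥0∞} (hp : 1 ≤ p) {m c : ℕ} (hmc : m ≤ c) (x : Fin m → ℝ) :
    lpNorm p x ≤ c * ‖x‖ := by
  have : Fact (1 ≤ p) := ⟨hp⟩
  rcases Nat.eq_zero_or_pos m with rfl | hm
  · rw [Subsingleton.elim x 0, lpNorm, WithLp.toLp_zero, norm_zero, norm_zero, mul_zero]
  have h := (PiLp.lipschitzWith_toLp p fun _ : Fin m => ℝ).dist_le_mul x 0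
  rw [WithLp.toLp_zero, dist_zero_right, dist_zero_right, Fintype.card_fin] at h
  refine h.trans (mul_le_mul_of_nonneg_right ?_ (norm_nonneg x))
  have h1 : (1 : ℝ) ≤ m := by exact_mod_cast hm
  have h2 : (1 / p).toReal ≤ 1 := by
    rw [one_div]
    exact ENNReal.toReal_le_of_le_ofReal zero_le_one
      (by simpa using ENNReal.inv_le_one.2 hp)
  have h3 : (m : ℝ) ^ (1 / p).toReal ≤ (m : ℝ) ^ (1 : ℝ) := Real.rpow_le_rpow_of_exponent_le h1 h2
  rw [Real.rpow_one] at h3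
  push_cast
  exact h3.trans (by exact_mod_cast hmc)

theorem NetApprox.mono {X : Type} [NormedAddCommGroup X] [NormedSpace ℝ X] {S : Set X}
    {Λ Λ' δ δ' : ℝ} {w w' L L' : ℕ} {h : X → ℝ} (hh : NetApprox S Λ δ w L h) (hΛ : Λ ≤ Λ')
    (hδ : δ ≤ δ') (hw : w ≤ w') (hw' : 2 ≤ w') (hL : L ≤ L') : NetApprox S Λ' δ' w' L' h := by
  obtain ⟨h1, f, hf, h2⟩ := hh
  exact ⟨fun x hx y hy => (h1 x hx y hy).trans (mul_le_mul_of_nonneg_right hΛ (norm_nonneg _)),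
    f, (hf.mono hw).deepen hw' hL, fun x hx => (h2 x hx).trans hδ⟩

/-- In the sup norm neither the error nor the Lipschitz constant grows with `n`; only the width
does. -/
theorem NetApprox.of_coordinates {d n w L : ℕ} (hn : 1 ≤ n) {a b Λ δ : ℝ} (hΛ : 0 ≤ Λ)
    (hδ : 0 ≤ δ) {g : (Fin d → ℝ) → (Fin n → ℝ)}
    (hg : ∀ j, ∃ (m : ℕ) (σ : Fin m → Fin d) (h : (Fin m → ℝ) → ℝ),
      NetApprox (cube m a b) Λ δ w L h ∧ ∀ x ∈ cube d a b, g x j = h (fun i => x (σ i))) :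
    NetApprox (cube d a b) Λ δ (n * w) L g := by
  have : Nonempty (Fin n) := ⟨⟨0, hn⟩⟩
  choose m σ h hh hgx using hg
  have hcube : ∀ j, ∀ x ∈ cube d a b, (fun i => x (σ j i)) ∈ cube (m j) a b :=
    fun j x hx i => hx _
  choose h1 f hf h2 using hh
  refine ⟨fun x hx y hy => ?_, fun x j => f j (fun i => x (σ j i)), ?_, fun x hx => ?_⟩
  · refine (pi_norm_le_iff_of_nonneg (by positivity)).2 fun j => ?_
    rw [Pi.sub_apply, hgx j x hx, hgx j y hy]
    refine (h1 j _ (hcube j x hx) _ (hcube j y hy)).trans (mul_le_mul_of_nonneg_left ?_ hΛ)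
    exact (pi_norm_le_iff_of_nonneg (norm_nonneg _)).2 fun i => norm_le_pi_norm (x - y) (σ j i)
  · have := IsNet.pi_const fun j =>
      (hf j).comp_affine (LinearMap.funLeft ℝ ℝ (σ j)).toAffineMap
    rw [Fintype.card_fin] at this
    exact this
  · refine (pi_norm_le_iff_of_nonneg hδ).2 fun j => ?_
    rw [Pi.sub_apply, hgx j x hx]
    exact h2 j _ (hcube j x hx)

/-- The bounds are common majorants. The factor `c` in `c * M` is the price of passing from the
`p`-norm to the sup norm; the depth adds `c + 1` for interpolation and `3 * M` for products. -/
theorem netApprox_of_mem_classes {c M N d n : ℕ} (hc : 1 ≤ c) (hN : 1 ≤ N) (hM : 1 ≤ M)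
    (hd : d ≤ M) (hn : 1 ≤ n) {a b : ℝ} (hab : a < b) (hba : b - a ≤ 2 * M) {p : ℝ≥0∞}
    (hp : 1 ≤ p) {g : (Fin d → ℝ) → (Fin n → ℝ)}
    (hg : g ∈ parLipschitz c p d n a b M ∪ extMax d n a b ∪ extProd d n a b ∪ parMax d n a b ∪
      parProd d n a b)
    (hprod : g ∈ parProd d n a b ∪ extProd d n a b → -1 ≤ a ∧ b ≤ 1) :
    NetApprox (cube d a b) (c * M) (8 * c * M ^ 2 / N) (n * (24 * (c + 1) * M * (N + 1) ^ c))
      (c + 1 + 3 * M) g := by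
  have hcR : (1 : ℝ) ≤ c := by exact_mod_cast hc
  have hMR : (1 : ℝ) ≤ M := by exact_mod_cast hM
  have hNR : (1 : ℝ) ≤ N := by exact_mod_cast hN
  have hw2 : 2 ≤ 24 * (c + 1) * M * (N + 1) ^ c :=
    calc 2 ≤ 24 * (0 + 1) * 1 * 1 := by norm_num
      _ ≤ _ := Nat.mul_le_mul (Nat.mul_le_mul (by omega) hM) (Nat.one_le_pow _ _ (by omega))
  have hNc : N + 1 ≤ (N + 1) ^ c := Nat.le_self_pow (by omega) _
  have hmax : ∀ m, 1 ≤ m → m ≤ d → NetApprox (cube m a b) (c * M) (8 * c * M ^ 2 / N)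
      (24 * (c + 1) * M * (N + 1) ^ c) (c + 1 + 3 * M) maxFn := by
    intro m hm hmd
    obtain ⟨m, rfl⟩ := Nat.exists_eq_add_of_le' hm
    refine (netApprox_maxFn (cube (m + 1) a b)).mono ?_ (by positivity) ?_ hw2 (by omega)
    · nlinarith
    · calc (m + 1) * 3 ≤ M * 3 := Nat.mul_le_mul_right _ (hmd.trans hd)
        _ ≤ 24 * (0 + 1) * M * 1 := by omega
        _ ≤ _ := Nat.mul_le_mul (Nat.mul_le_mul_right _ (by omega))
          (Nat.one_le_pow _ _ (by omega))
  have hprodFn : -1 ≤ a ∧ b ≤ 1 → ∀ m, 1 ≤ m → m ≤ d →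
      NetApprox (cube m a b) (c * M) (8 * c * M ^ 2 / N)
      (24 * (c + 1) * M * (N + 1) ^ c) (c + 1 + 3 * M) prodFn := by
    intro hab m hm hmd
    obtain ⟨m, rfl⟩ := Nat.exists_eq_add_of_le' hm
    have hmM : ((m + 1 : ℕ) : ℝ) ≤ M := by exact_mod_cast hmd.trans hd
    refine (netApprox_prodFn hN hab.1 hab.2).mono ?_ ?_ ?_ hw2 (by omega)
    · nlinarith
    · rw [mul_div_assoc']
      refine div_le_div_of_nonneg_right ?_ (by positivity)
      push_cast at hmM
      have h1 : (M : ℝ) ≤ c * M ^ 2 := by nlinarith [mul_le_mul hcR hMR zero_le_one (by positivity)]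
      linarith
    · calc (m + 1) * (24 * (N + 1)) ≤ M * (24 * (N + 1) ^ c) :=
          Nat.mul_le_mul (hmd.trans hd) (Nat.mul_le_mul_left _ hNc)
        _ = 24 * (0 + 1) * M * (N + 1) ^ c := by ring
        _ ≤ _ := by gcongr; omega
  refine NetApprox.of_coordinates hn (by positivity) (by positivity) fun j => ?_
  have hblock : ∀ (ds : Fin n → ℕ), ∑ i, ds i = d → ds j ≤ d := fun ds h =>
    h ▸ Finset.single_le_sum (fun _ _ => Nat.zero_le _) (Finset.mem_univ j)
  rcases hg with (((hg | hg) | hg) | hg) | hg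
  · obtain ⟨ds, h, f, hds, hf, hgf⟩ := hg
    refine ⟨ds j, fun i => Fin.cast h (finSigmaFinEquiv ⟨j, i⟩), f j, ?_,
      fun x hx => congrFun (hgf hx) j⟩
    refine (netApprox_of_lipschitz (Λ := c * M) hN hab (by positivity) fun x hx y hy => ?_).mono
      le_rfl ?_ ?_ hw2 ?_
    · refine (hf j x hx y hy).trans ?_
      rw [mul_comm (c : ℝ), mul_assoc]
      exact mul_le_mul_of_nonneg_left (lpNorm_le hp (hds j).2 _) (by positivity)
    · rw [mul_div_assoc']
      refine div_le_div_of_nonneg_right ?_ (by positivity)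
      calc (c * M * (b - a) : ℝ) ≤ c * M * (2 * M) := by gcongr
        _ ≤ 8 * c * M ^ 2 := by nlinarith [show (0 : ℝ) ≤ c * M ^ 2 by positivity]
    · calc (N + 1) ^ ds j * (6 * (ds j + 1)) ≤ (N + 1) ^ c * (6 * (c + 1)) := by
            have := (hds j).2
            gcongr
            omega
        _ = 6 * (c + 1) * 1 * (N + 1) ^ c := by ring
        _ ≤ _ := by gcongr; norm_num
    · have := (hds j).2
      omega
  · obtain ⟨rfl, hg⟩ := hg
    exact ⟨j + 1, Fin.castLE j.isLt, maxFn, hmax _ (by omega) j.isLt, fun x hx => hg x hx j⟩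
  · obtain ⟨rfl, hg'⟩ := id hg
    exact ⟨j + 1, Fin.castLE j.isLt, prodFn, hprodFn (hprod (.inr hg)) _ (by omega) j.isLt,
      fun x hx => hg' x hx j⟩
  · obtain ⟨ds, h, hds, hgf⟩ := hg
    exact ⟨ds j, fun i => Fin.cast h (finSigmaFinEquiv ⟨j, i⟩), maxFn,
      hmax _ (hds j) (hblock ds h), fun x hx => congrFun (hgf hx) j⟩
  · obtain ⟨ds, h, hds, hgf⟩ := id hg
    exact ⟨ds j, fun i => Fin.cast h (finSigmaFinEquiv ⟨j, i⟩), prodFn,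
      hprodFn (hprod (.inl hg)) _ (hds j) (hblock ds h), fun x hx => congrFun (hgf hx) j⟩

/-! ### Compositions -/

/-- A clamping layer precedes each factor. As the exact value lies in the cube, clamping does not
increase the distance to it. The errors satisfy `e (i + 1) ≤ δ + Λ * e i`, whence `i * Λ ^ i * δ`.
-/
theorem exists_net_compose {D : ℕ → ℕ} {g : ∀ i, (Fin (D i) → ℝ) → (Fin (D (i + 1)) → ℝ)}
    {a b : ℕ → ℝ} {k W L : ℕ} {Λ δ : ℝ} (hΛ : 1 ≤ Λ) (hδ : 0 ≤ δ)
    (hD : ∀ i, 1 ≤ i → i ≤ k → 1 ≤ D i) (hW : ∀ i, 1 ≤ i → i ≤ k → D i * 2 ≤ W)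
    (hab : ∀ i, 1 ≤ i → i ≤ k → a i < b i)
    (hg : ∀ i, 1 ≤ i → i ≤ k → NetApprox (cube (D i) (a i) (b i)) Λ δ W L (g i))
    (hmaps : ∀ i, 1 ≤ i → i ≤ k - 1 → Set.MapsTo (g i) (cube (D i) (a i) (b i))
      (cube (D (i + 1)) (a (i + 1)) (b (i + 1)))) (i : ℕ) (hi : i ≤ k) :
    ∃ G : (Fin (D 1) → ℝ) → (Fin (D (i + 1)) → ℝ),
      IsNet W (Fin (D (i + 1)) → ℝ) (i * (L + 1)) (Fin (D 1) → ℝ) G ∧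
      ∀ x ∈ cube (D 1) (a 1) (b 1), ‖G x - compose g i x‖ ≤ i * Λ ^ i * δ := by
  have hmem : ∀ i, i + 1 ≤ k → ∀ x ∈ cube (D 1) (a 1) (b 1),
      compose g i x ∈ cube (D (i + 1)) (a (i + 1)) (b (i + 1)) := by
    intro i
    induction i with
    | zero => exact fun _ x hx => hx
    | succ i ih => exact fun hi x hx => hmaps (i + 1) (by omega) (by omega) (ih (by omega) x hx)
  induction i with
  | zero =>
    refine ⟨id, ?_, fun x _ => by simp [compose]⟩
    rw [zero_mul]
    exact IsNet.affine _ (AffineMap.id ℝ _)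
  | succ i ih =>
    obtain ⟨G, hG, hGx⟩ := ih (by omega)
    obtain ⟨hlip, f, hf, hfx⟩ := hg (i + 1) (by omega) hi
    have hab' := hab (i + 1) (by omega) hi
    have : Nonempty (Fin (D (i + 1))) := ⟨⟨0, hD (i + 1) (by omega) hi⟩⟩
    let clamp : (Fin (D (i + 1)) → ℝ) → (Fin (D (i + 1)) → ℝ) :=
      fun y j => max (a (i + 1)) (min (b (i + 1)) (y j))
    have hclamp : IsNet W (Fin (D (i + 1)) → ℝ) 1 (Fin (D (i + 1)) → ℝ) clamp := by
      have := IsNet.pi_const fun j : Fin (D (i + 1)) =>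
        (isNet_clamp hab'.le).comp (IsNet.apply 2 j)
      rw [Fintype.card_fin] at this
      exact this.mono (hW (i + 1) (by omega) hi)
    refine ⟨fun x => f (clamp (G x)), ?_, fun x hx => ?_⟩
    · have := hf.comp (hclamp.comp hG)
      have e : (i + 1) * (L + 1) = L + (1 + i * (L + 1)) := by ring
      rwa [e]
    · have h1 : clamp (G x) ∈ cube (D (i + 1)) (a (i + 1)) (b (i + 1)) := fun j =>
        ⟨le_max_left _ _, max_le hab'.le (min_le_left _ _)⟩
      have h2 := hmem i hi x hx
      have h3 : ‖clamp (G x) - compose g i x‖ ≤ i * Λ ^ i * δ := by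
        refine (pi_norm_le_iff_of_nonneg (by positivity)).2 fun j => ?_
        exact (abs_clamp_sub_le (h2 j)).trans ((norm_le_pi_norm (G x - compose g i x) j).trans
          (hGx x hx))
      have h4 := hfx _ h1
      have h5 := hlip _ h1 _ h2
      have h6 : (1 : ℝ) ≤ Λ ^ (i + 1) := one_le_pow₀ hΛ
      calc ‖f (clamp (G x)) - g (i + 1) (compose g i x)‖
          ≤ ‖f (clamp (G x)) - g (i + 1) (clamp (G x))‖ +
            ‖g (i + 1) (clamp (G x)) - g (i + 1) (compose g i x)‖ :=
          norm_sub_le_norm_sub_add_norm_sub _ _ _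
        _ ≤ Λ ^ (i + 1) * δ + Λ * (i * Λ ^ i * δ) :=
          add_le_add (h4.trans (le_mul_of_one_le_left hδ h6))
            (h5.trans (mul_le_mul_of_nonneg_left h3 (by positivity)))
        _ = ((i + 1 : ℕ) : ℝ) * Λ ^ (i + 1) * δ := by push_cast; ring

theorem NetApprox.mono_width {X Y : Type} [NormedAddCommGroup X] [NormedSpace ℝ X]
    [NormedAddCommGroup Y] [NormedSpace ℝ Y] {S : Set X} {Λ δ : ℝ} {w w' L : ℕ} {h : X → Y}
    (hh : NetApprox S Λ δ w L h) (hw : w ≤ w') : NetApprox S Λ δ w' L h := by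
  obtain ⟨h1, f, hf, h2⟩ := hh
  exact ⟨h1, f, hf.mono hw, h2⟩

/-! ### Parameter count and choice of constants -/

/-- The width is `O(M ^ 2 * (T / ε) ^ c)`; its square times a depth `O(M)` gives `M ^ 5` and `ε ^
(-2c)`. -/
theorem params_bound {c k M N : ℕ} (hM : 1 ≤ M) {ε T : ℝ} (hε : 0 < ε) (hN : (N : ℝ) + 1 ≤ T / ε)
    {W : ℕ} (hW : W = M * (24 * (c + 1) * M * (N + 1) ^ c)) :
    (((k * (c + 1 + 3 * M + 1) + 1) * (W * (W + 1)) : ℕ) : ℝ) ≤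
      (k * (c + 5) + 1) * (2 * (24 * (c + 1) * T ^ c) ^ 2) * (M : ℝ) ^ 5 *
        ε ^ (-(2 * (c : ℤ))) := by
  have hMR : (1 : ℝ) ≤ M := by exact_mod_cast hM
  have hε' : 0 < ε⁻¹ := inv_pos.2 hε
  have h1 : ((k * (c + 1 + 3 * M + 1) + 1 : ℕ) : ℝ) ≤ (k * (c + 5) + 1) * M := by
    have : k * (c + 1 + 3 * M + 1) + 1 ≤ (k * (c + 5) + 1) * M := by
      have : k * (c + 1 + 3 * M + 1) ≤ k * ((c + 5) * M) := Nat.mul_le_mul_left _ (by nlinarith)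
      nlinarith
    exact_mod_cast this
  have h2 : (W : ℝ) ≤ 24 * (c + 1) * T ^ c * M ^ 2 * (ε⁻¹) ^ c := by
    have h3 : ((N : ℝ) + 1) ^ c ≤ (T / ε) ^ c := by gcongr
    rw [div_eq_mul_inv, mul_pow] at h3
    rw [hW]
    push_cast
    calc (M * (24 * (c + 1) * M * (N + 1) ^ c) : ℝ)
        ≤ M * (24 * (c + 1) * M * (T ^ c * (ε⁻¹) ^ c)) := by gcongr
      _ = _ := by ring
  have hW1 : 1 ≤ W := by
    rw [hW]
    exact Nat.one_le_iff_ne_zero.2 (by positivity)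
  have h4 : ((W * (W + 1) : ℕ) : ℝ) ≤ 2 * (W : ℝ) ^ 2 := by
    have : (1 : ℝ) ≤ W := by exact_mod_cast hW1
    push_cast
    nlinarith
  have h5 : ε ^ (-(2 * (c : ℤ))) = ((ε⁻¹) ^ c) ^ 2 := by
    rw [zpow_neg, ← pow_mul, inv_pow, mul_comm c 2]
    norm_cast
  rw [Nat.cast_mul, h5]
  calc _ ≤ ((k * (c + 5) + 1) * M : ℝ) * (2 * (24 * (c + 1) * T ^ c * M ^ 2 * (ε⁻¹) ^ c) ^ 2) :=
        mul_le_mul h1 (h4.trans (by gcongr)) (Nat.cast_nonneg _) (by positivity)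
    _ = _ := by ring

end ReLUApprox

theorem theorem1p2 (c k : ℕ) (hc : 1 ≤ c) (hk : 1 ≤ k)
    (D : ℕ → ℕ → ℕ)
    (hD : ∀ d, 1 ≤ d → ∀ i, 1 ≤ i → i ≤ k + 1 → 1 ≤ D d i ∧ D d i ≤ c * d ^ c)
    (a b : ℕ → ℕ → ℝ)
    (hab : ∀ d, 1 ≤ d → ∀ i, 1 ≤ i → i ≤ k → a d i < b d i)
    (hQ : ∀ d, 1 ≤ d → ∀ i, 1 ≤ i → i ≤ k →
      cube (D d i) (a d i) (b d i) ⊆ cube (D d i) (-((c : ℝ) * (d : ℝ) ^ c)) ((c : ℝ) * (d : ℝ) ^ c))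
    (g : ∀ d i, (Fin (D d i) → ℝ) → (Fin (D d (i + 1)) → ℝ))
    (hg : ∀ d, 1 ≤ d → ∀ i, 1 ≤ i → i ≤ k →
      ContinuousOn (g d i) (cube (D d i) (a d i) (b d i)))
    (p : ℝ≥0∞) (hp : 1 ≤ p)
    (hclass : ∀ d, 1 ≤ d → ∀ i, 1 ≤ i → i ≤ k →
      g d i ∈ parLipschitz c p (D d i) (D d (i + 1)) (a d i) (b d i) ((c : ℝ) * (d : ℝ) ^ c)
        ∪ extMax (D d i) (D d (i + 1)) (a d i) (b d i)
        ∪ extProd (D d i) (D d (i + 1)) (a d i) (b d i)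
        ∪ parMax (D d i) (D d (i + 1)) (a d i) (b d i)
        ∪ parProd (D d i) (D d (i + 1)) (a d i) (b d i))
    (hmaps : ∀ d, 1 ≤ d → ∀ i, 1 ≤ i → i ≤ k - 1 →
      Set.MapsTo (g d i) (cube (D d i) (a d i) (b d i))
        (cube (D d (i + 1)) (a d (i + 1)) (b d (i + 1))))
    (hprod : ∀ d, 1 ≤ d → ∀ i, 1 ≤ i → i ≤ k →
      g d i ∈ parProd (D d i) (D d (i + 1)) (a d i) (b d i)
        ∪ extProd (D d i) (D d (i + 1)) (a d i) (b d i) →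
      cube (D d i) (a d i) (b d i) ⊆ cube (D d i) (-1) 1)
    (F : ∀ d, (Fin (D d 1) → ℝ) → (Fin (D d (k + 1)) → ℝ))
    (hFc : ∀ d, 1 ≤ d → ContinuousOn (F d) (cube (D d 1) (a d 1) (b d 1)))
    (hF : ∀ d, 1 ≤ d → Set.EqOn (F d) (compose (g d) k) (cube (D d 1) (a d 1) (b d 1))) :
    ∃ K : ℕ, 1 ≤ K ∧ ∀ d : ℕ, 1 ≤ d → ∀ ε : ℝ, 0 < ε → ε ≤ 1 →
      ∃ Φ : Network (D d 1) (D d (k + 1)),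
        Continuous Φ.realize ∧
        (Φ.params : ℝ) ≤ (K : ℝ) * (d : ℝ) ^ K * ε ^ (-(2 * (c : ℤ))) ∧
        ∀ x ∈ cube (D d 1) (a d 1) (b d 1), lpNorm p (Φ.realize x - F d x) ≤ ε := by
  -- `C` and `E` are the coefficient and the power of `d` that arise from `M = c * d ^ c` in
  -- `params_bound`. Their sum plus 1 serves as both factor and exponent.
  obtain ⟨C, hC⟩ : ∃ C : ℕ, C = (k * (c + 5) + 1) *
    (2 * (24 * (c + 1) * (10 * c ^ (k + 1) * k * c ^ (k + 3)) ^ c) ^ 2) * c ^ 5 := ⟨_, rfl⟩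
  obtain ⟨E, hE⟩ : ∃ E : ℕ, E = c * (k + 3) * c * 2 + c * 5 := ⟨_, rfl⟩
  refine ⟨C + E + 1, by omega, fun d hd ε hε hε1 => ?_⟩
  obtain ⟨M, hM⟩ : ∃ M : ℕ, M = c * d ^ c := ⟨_, rfl⟩
  have hMR : (c : ℝ) * (d : ℝ) ^ c = M := by rw [hM]; push_cast; rfl
  have hM1 : 1 ≤ M := hM ▸ Nat.mul_pos hc (Nat.pow_pos hd)
  have hcR : (1 : ℝ) ≤ c := by exact_mod_cast hc
  have hkR : (1 : ℝ) ≤ k := by exact_mod_cast hk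
  have hdR : (1 : ℝ) ≤ d := by exact_mod_cast hd
  have hM1R : (1 : ℝ) ≤ M := by exact_mod_cast hM1
  have hD' := hD d hd
  have hab' := hab d hd
  have hQ' := hQ d hd
  have hclass' := hclass d hd
  rw [← hM] at hD'
  rw [hMR] at hQ' hclass'
  have hends : ∀ i, 1 ≤ i → i ≤ k → ∀ l u : ℝ,
      cube (D d i) (a d i) (b d i) ⊆ cube (D d i) l u → l ≤ a d i ∧ b d i ≤ u := by
    intro i h1 h2 l u h
    have hi := hab' i h1 h2
    have j : Fin (D d i) := ⟨0, (hD' i h1 (by omega)).1⟩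
    exact ⟨(h (a := fun _ => a d i) (fun _ => ⟨le_rfl, hi.le⟩) j).1,
      (h (a := fun _ => b d i) (fun _ => ⟨hi.le, le_rfl⟩) j).2⟩
  have hΛ : (1 : ℝ) ≤ c * M := by nlinarith
  -- This makes the composed error `k * (c * M) ^ k * (8 * c * M ^ 2 / N)`, times the factor `M` for
  -- returning to the `p`-norm, at most `ε`.
  obtain ⟨N, hN⟩ : ∃ N : ℕ, N = ⌈8 * c * (M : ℝ) ^ 2 * (M * k * (c * M) ^ k) / ε⌉₊ := ⟨_, rfl⟩
  have hNpos : 0 < 8 * c * (M : ℝ) ^ 2 * (M * k * (c * M) ^ k) / ε := by positivity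
  have hN1 : 1 ≤ N := hN ▸ Nat.ceil_pos.2 hNpos
  have hNle : (N : ℝ) + 1 ≤ 10 * c ^ (k + 1) * k * (M : ℝ) ^ (k + 3) / ε := by
    have h1 := (Nat.ceil_lt_add_one hNpos.le).le
    rw [← hN] at h1
    -- Rounding up and the extra 1 cost 2 in total, absorbed because `ε ≤ 1`; thus `8 + 2 = 10`.
    have h2 : 2 ≤ 2 * ((c : ℝ) ^ (k + 1) * k * (M : ℝ) ^ (k + 3)) / ε := by
      rw [le_div_iff₀ hε]
      have h3 : 1 ≤ (c : ℝ) ^ (k + 1) * k * (M : ℝ) ^ (k + 3) :=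
        one_le_mul_of_one_le_of_one_le
          (one_le_mul_of_one_le_of_one_le (one_le_pow₀ hcR) hkR) (one_le_pow₀ hM1R)
      linarith
    calc (N : ℝ) + 1 ≤ 8 * c * (M : ℝ) ^ 2 * (M * k * (c * M) ^ k) / ε +
          2 * ((c : ℝ) ^ (k + 1) * k * (M : ℝ) ^ (k + 3)) / ε := by linarith
      _ = _ := by rw [mul_pow]; ring
  obtain ⟨W, hW⟩ : ∃ W : ℕ, W = M * (24 * (c + 1) * M * (N + 1) ^ c) := ⟨_, rfl⟩
  have hMW : M * 2 ≤ W := by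
    rw [hW]
    refine Nat.mul_le_mul_left _ ?_
    calc 2 ≤ 24 * (0 + 1) * 1 * 1 := by norm_num
      _ ≤ _ := Nat.mul_le_mul (Nat.mul_le_mul (by omega) hM1) (Nat.one_le_pow _ _ (by omega))
  obtain ⟨G, hG, hGx⟩ := exists_net_compose (D := D d) (g := g d) (a := a d) (b := b d) (k := k)
    (W := W) (L := c + 1 + 3 * M) (δ := 8 * c * (M : ℝ) ^ 2 / N) hΛ (by positivity)
    (fun i h1 h2 => (hD' i h1 (by omega)).1)
    (fun i h1 h2 => (Nat.mul_le_mul_right 2 (hD' i h1 (by omega)).2).trans hMW) hab'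
    (fun i h1 h2 => by
      obtain ⟨h3, h4⟩ := hends i h1 h2 _ _ (hQ' i h1 h2)
      refine (netApprox_of_mem_classes hc hN1 hM1 (hD' i h1 (by omega)).2
        (hD' (i + 1) (by omega) (by omega)).1 (hab' i h1 h2) (by linarith) hp (hclass' i h1 h2)
        fun h => hends i h1 h2 _ _ (hprod d hd i h1 h2 h)).mono_width ?_
      rw [hW]
      exact Nat.mul_le_mul_right _ (hD' (i + 1) (by omega) (by omega)).2)
    (hmaps d hd) k le_rfl
  have hD1 := hD' 1 le_rfl (by omega)
  have hDk := hD' (k + 1) (by omega) le_rfl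
  obtain ⟨Φ, hΦ, hp1⟩ := hG.exists_network hD1.1 hDk.1 (by omega) (by omega)
  refine ⟨Φ, Φ.continuous_realize, ?_, fun x hx => ?_⟩
  · have hC1 : (((k * (c + 5) + 1) *
        (2 * (24 * (c + 1) * (10 * c ^ (k + 1) * k * (M : ℝ) ^ (k + 3)) ^ c) ^ 2) * (M : ℝ) ^ 5)) =
        C * (d : ℝ) ^ E := by
      rw [hC, hE, ← hMR]
      push_cast
      simp only [mul_pow, pow_add, pow_mul]
      ring
    calc (Φ.params : ℝ) ≤ (((k * (c + 1 + 3 * M + 1) + 1) * (W * (W + 1)) : ℕ) : ℝ) := by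
          exact_mod_cast hp1
      _ ≤ C * (d : ℝ) ^ E * ε ^ (-(2 * (c : ℤ))) := by
          rw [← hC1]
          exact params_bound hM1 hε hNle hW
      _ ≤ _ := by
          gcongr
          · linarith [(Nat.cast_nonneg E : (0 : ℝ) ≤ E)]
          · omega
  · rw [hΦ, hF d hd hx]
    refine (lpNorm_le hp hDk.2 _).trans ?_
    have h1 := hGx x hx
    have h2 : 8 * c * (M : ℝ) ^ 2 * (M * k * (c * M) ^ k) / ε ≤ N := hN ▸ Nat.le_ceil _
    have hNR : (0 : ℝ) < N := by exact_mod_cast hN1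
    calc (M : ℝ) * ‖G x - compose (g d) k x‖
        ≤ M * (k * (c * M) ^ k * (8 * c * (M : ℝ) ^ 2 / N)) := by gcongr
      _ = 8 * c * (M : ℝ) ^ 2 * (M * k * (c * M) ^ k) / N := by ring
      _ ≤ ε := by
        rw [div_le_iff₀ hε] at h2
        rw [div_le_iff₀ hNR]
        linarith
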